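/- Let $\Pi$ be the orthogonal projection on $L^2(\mathbb{R})$ (complex-valued functions) given by $(\Pi f)(x)=f(x)$ for $x>0$ and $(\Pi f)(x)=0$ for $x<0$. Let $\mathcal{F}$ be the unitary Fourier transform on $L^2(\mathbb{R})$, $(\mathcal{F}f)(k)=\frac{1}{\sqrt{2\pi}}\int_{-\infty}^{\infty}e^{-ikx}f(x)\,dx$ (extended from Schwartz functions by continuity), with adjoint $\mathcal{F}^*$, and for $t\in\mathbb{R}$ let $U_t$ be the unitary operator $(U_t\phi)(k)=e^{-ik^2t}\phi(k)$. Put $\widetilde{\Pi}_t:=U_t^*\mathcal{F}\Pi\mathcal{F}^*U_t$ and $B:=\widetilde{\Pi}_{-1}-\widetilde{\Pi}_{1}$. Then the backflow operator $\Pi B\Pi$ on $L^2(\mathbb{R})$ is not compact. Moreover, $-1$ belongs to the spectrum of $\Pi B\Pi$ but is not an eigenvalue of it. -/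

import Mathlib

open MeasureTheory
open scoped ENNReal

namespace Backflow

/-- The complex Hilbert space `L²(ℝ)`, with respect to Lebesgue measure. -/
abbrev L2 : Type := Lp ℂ 2 (volume : Measure ℝ)

/-- Multiplication on `L²(ℝ)` by an essentially bounded function `g`: the operator `f ↦ g f`. -/
noncomputable def mulOp (g : ℝ → ℂ) (hg : MemLp g ∞ volume) : L2 →L[ℂ] L2 :=
  (ContinuousLinearMap.mul ℂ ℂ).holderL volume ∞ 2 2 hg.toLp

theorem memLp_halfLine :
    MemLp ((Set.Ioi (0 : ℝ)).indicator (fun _ : ℝ => (1 : ℂ))) ∞ volume :=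
  (memLp_top_const (1 : ℂ)).indicator measurableSet_Ioi

/-- The orthogonal projection `Π` : `(Π f)(x) = f(x)` for `x > 0` and `(Π f)(x) = 0` for
`x < 0`. -/
noncomputable def halfLineProj : L2 →L[ℂ] L2 :=
  mulOp ((Set.Ioi (0 : ℝ)).indicator (fun _ : ℝ => (1 : ℂ))) memLp_halfLine

theorem memLp_phase (t : ℝ) :
    MemLp (fun k : ℝ => Complex.exp (-(Complex.I * (k : ℂ) ^ 2 * (t : ℂ)))) ∞ volume := by
  refine memLp_top_of_bound (by fun_prop) 1 (Filter.Eventually.of_forall fun k => ?_)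
  rw [show -(Complex.I * (k : ℂ) ^ 2 * (t : ℂ)) = ((-(k ^ 2 * t) : ℝ) : ℂ) * Complex.I by
    push_cast; ring, Complex.norm_exp_ofReal_mul_I]

/-- The free Schrödinger evolution in the momentum representation:
`(U_t φ)(k) = exp(-i k² t) φ(k)`. -/
noncomputable def freeEvolution (t : ℝ) : L2 →L[ℂ] L2 :=
  mulOp (fun k : ℝ => Complex.exp (-(Complex.I * (k : ℂ) ^ 2 * (t : ℂ)))) (memLp_phase t)

theorem quasiMeasurePreserving_mul_left {c : ℝ} (hc : 0 < c) :
    Measure.QuasiMeasurePreserving (fun x : ℝ => c * x) volume volume := by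
  refine ⟨by fun_prop, ?_⟩
  rw [Real.map_volume_mul_left hc.ne']
  exact Measure.smul_absolutelyContinuous

theorem eLpNorm_dilate {c : ℝ} (hc : 0 < c) (f : L2) :
    eLpNorm (fun x : ℝ => (Real.sqrt c : ℂ) * f (c * x)) 2 volume = eLpNorm f 2 volume := by
  have h1 : eLpNorm (fun x : ℝ => f (c * x)) 2 volume
      = eLpNorm f 2 (Measure.map (fun x : ℝ => c * x) volume) := by
    rw [eLpNorm_map_measure _ (by fun_prop)]
    · rfl
    · rw [Real.map_volume_mul_left hc.ne']
      exact (Lp.aestronglyMeasurable f).smul_measure _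
  have h2 : (fun x : ℝ => (Real.sqrt c : ℂ) * f (c * x))
      = (Real.sqrt c : ℂ) • fun x : ℝ => f (c * x) := rfl
  rw [h2, eLpNorm_const_smul, h1, Real.map_volume_mul_left hc.ne',
    eLpNorm_smul_measure_of_ne_top (by norm_num), smul_eq_mul, ← mul_assoc]
  have h3 : ‖(Real.sqrt c : ℂ)‖ₑ * ENNReal.ofReal |c⁻¹| ^ (1 / (2 : ℝ≥0∞)).toReal = 1 := by
    rw [← ofReal_norm, ENNReal.ofReal_rpow_of_nonneg (abs_nonneg _) (by positivity),
      ← ENNReal.ofReal_mul (norm_nonneg _), Complex.norm_real, Real.norm_of_nonneg (by positivity),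
      abs_of_pos (inv_pos.2 hc)]
    have : (1 / (2 : ℝ≥0∞)).toReal = 1 / 2 := by simp
    rw [this, ← Real.sqrt_eq_rpow, ← Real.sqrt_mul hc.le, mul_inv_cancel₀ hc.ne']
    simp
  rw [h3, one_mul]

theorem memLp_dilate {c : ℝ} (hc : 0 < c) (f : L2) :
    MemLp (fun x : ℝ => (Real.sqrt c : ℂ) * f (c * x)) 2 volume := by
  refine ⟨?_, ?_⟩
  · exact ((Lp.aestronglyMeasurable f).comp_quasiMeasurePreserving
      (quasiMeasurePreserving_mul_left hc)).const_mul _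
  · rw [eLpNorm_dilate hc]
    exact Lp.eLpNorm_lt_top f

/-- The isometric dilation `(V_c f)(x) = √c f(c x)` of `L²(ℝ)`, for `c > 0`. -/
noncomputable def dilation (c : ℝ) (hc : 0 < c) : L2 →ₗᵢ[ℂ] L2 where
  toFun f := (memLp_dilate hc f).toLp
  map_add' f g := by
    rw [← MemLp.toLp_add, MemLp.toLp_eq_toLp_iff]
    filter_upwards [(quasiMeasurePreserving_mul_left hc).ae (Lp.coeFn_add f g)] with x hx
    simp only [Pi.add_apply] at hx ⊢
    rw [hx, mul_add]
  map_smul' a f := by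
    rw [RingHom.id_apply, ← MemLp.toLp_const_smul, MemLp.toLp_eq_toLp_iff]
    filter_upwards [(quasiMeasurePreserving_mul_left hc).ae (Lp.coeFn_smul a f)] with x hx
    simp only [Pi.smul_apply, smul_eq_mul] at hx ⊢
    rw [hx, mul_left_comm]
  norm_map' f := by
    change ‖(memLp_dilate hc f).toLp‖ = ‖f‖
    rw [Lp.norm_toLp, eLpNorm_dilate hc, Lp.norm_def]

/-- The unitary Fourier transform on `L²(ℝ)` with the convention
`(F f)(k) = (2π)^(-1/2) ∫ exp(-i k x) f(x) dx`. Mathlib's transform is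
`(𝓕 f)(ξ) = ∫ exp(-2π i ξ x) f(x) dx`, so that `(F f)(k) = (2π)^(-1/2) (𝓕 f)(k / 2π)`. -/
noncomputable def fourierL2 : L2 →L[ℂ] L2 :=
  (dilation (1 / (2 * Real.pi)) (by positivity)).toContinuousLinearMap ∘L
    (Lp.fourierTransformₗᵢ ℝ ℂ).toContinuousLinearEquiv.toContinuousLinearMap

/-- The projection `U_t* F Π F* U_t`: if `‖φ‖ = 1`, its expectation in the state `φ` is the
probability that a position measurement at time `t` yields a value `> 0`. -/
noncomputable def positionProj (t : ℝ) : L2 →L[ℂ] L2 :=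
  ContinuousLinearMap.adjoint (freeEvolution t) ∘L fourierL2 ∘L halfLineProj ∘L
    ContinuousLinearMap.adjoint fourierL2 ∘L freeEvolution t

/-- `B_T = U_{-T}* F Π F* U_{-T} - U_T* F Π F* U_T`. -/
noncomputable def backflowB (T : ℝ) : L2 →L[ℂ] L2 :=
  positionProj (-T) - positionProj T

/-- The backflow operator `Π B_T Π` on `L²(ℝ)`. -/
noncomputable def backflowOperator (T : ℝ) : L2 →L[ℂ] L2 :=
  halfLineProj ∘L backflowB T ∘L halfLineProj

end Backflow

namespace Backflow

open Filter Topology Complex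
open scoped FourierTransform SchwartzMap InnerProductSpace ContDiff

/-! For a unit vector `φ` with positive momenta, `⟪φ, ΠBΠφ⟫` is the probability of `x > 0` at time
`-1` minus that at time `1`. The value `-1` demands a particle wholly on the left at time `-1` and
wholly on the right at time `1`.

This is approximated by fast particles. Boosting the momentum box to `[n, n + 1]` shifts its
position density at time `t` by `2nt` (`norm_fourierInv_boxFreq`), so both wrong-side masses tend to
`0`. The boxes are then approximate eigenvectors, and `-1` is in the spectrum.

It is never attained: an eigenvector would have a wave function at time `-1` vanishing on `x > 0`,
with Fourier transform vanishing on negative frequencies, hence would be zero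
(`eq_zero_of_halfLine_supports`). There the Cauchy transform is holomorphic off the negative
half-line and zero in the lower half-plane, so it is zero everywhere, and its values in the upper
half-plane determine the Fourier transform.

A nonzero spectral value of a compact operator is an eigenvalue, so the operator is not compact. -/

/-! ### Inverse Fourier transform on `L¹ ∩ L²` -/

theorem continuous_fourierInv {f : ℝ → ℂ} (hf : Integrable f) : Continuous (𝓕⁻ f) :=
  VectorFourier.fourierIntegral_continuous Real.continuous_fourierChar
    (L := -innerₗ ℝ) (by fun_prop) hf

theorem integral_mul_fourierInv {f g : ℝ → ℂ} (hf : Integrable f) (hg : Integrable g) :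
    ∫ x, 𝓕⁻ g x * f x = ∫ x, g x * 𝓕⁻ f x := by
  have h := VectorFourier.integral_fourierIntegral_smul_eq_flip (μ := volume) (ν := volume)
    (L := -innerₗ ℝ) Real.continuous_fourierChar (by fun_prop) hg hf
  have e : (-innerₗ ℝ : ℝ →ₗ[ℝ] ℝ →ₗ[ℝ] ℝ).flip = -innerₗ ℝ := by
    ext; simp
  rw [e] at h
  exact h

/-- On `L¹ ∩ L²` the inverse Fourier transform of `L²` is given by the integral. -/
theorem fourierInv_toLp_ae_eq {f : ℝ → ℂ} (h1 : Integrable f) (h2 : MemLp f 2 volume) :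
    ((𝓕⁻ (h2.toLp f : L2) : L2) : ℝ → ℂ) =ᵐ[volume] 𝓕⁻ f := by
  -- Both sides are locally integrable, so equality as distributions suffices.
  refine ae_eq_of_integral_contDiff_smul_eq ((Lp.memLp _).locallyIntegrable (by norm_num))
    (continuous_fourierInv h1).locallyIntegrable fun g g_smooth g_cpt => ?_
  have hg₁ : HasCompactSupport (Complex.ofRealCLM ∘ g) := g_cpt.comp_left rfl
  have hg₂ : ContDiff ℝ ∞ (Complex.ofRealCLM ∘ g) := by fun_prop
  set G : 𝓢(ℝ, ℂ) := hg₁.toSchwartzMap hg₂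
  have e1 := Lp.fourierInv_toTemperedDistribution_eq (h2.toLp f : L2)
  have e2 := congrArg (fun T => T G) e1
  simp only [TemperedDistribution.fourierInv_apply, Lp.toTemperedDistribution_apply] at e2
  have e3 : ∫ x, (𝓕⁻ G) x • (h2.toLp f : L2) x = ∫ x, 𝓕⁻ (G : ℝ → ℂ) x * f x := by
    refine integral_congr_ae ?_
    filter_upwards [h2.coeFn_toLp] with x hx
    rw [hx, SchwartzMap.fourierInv_coe, smul_eq_mul]
  rw [e3, integral_mul_fourierInv h1 G.integrable] at e2
  exact e2.symm

/-! ### Pointwise formulas, isometries and projections -/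

theorem mulOp_ae_eq (g : ℝ → ℂ) (hg : MemLp g ∞ volume) (f : L2) :
    (mulOp g hg f : ℝ → ℂ) =ᵐ[volume] fun x => g x * f x := by
  have h := (ContinuousLinearMap.mul ℂ ℂ).coeFn_holder (r := 2) (hg.toLp) f
  filter_upwards [h, hg.coeFn_toLp] with x h1 h2
  rw [← h2]
  exact h1

theorem halfLineProj_ae_eq (f : L2) :
    (halfLineProj f : ℝ → ℂ) =ᵐ[volume] (Set.Ioi (0 : ℝ)).indicator f := by
  filter_upwards [mulOp_ae_eq _ memLp_halfLine f] with x hx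
  refine hx.trans ?_
  by_cases h : x ∈ Set.Ioi (0 : ℝ) <;> simp [h]

theorem freeEvolution_ae_eq (t : ℝ) (f : L2) :
    (freeEvolution t f : ℝ → ℂ) =ᵐ[volume]
      fun k => Complex.exp (-(Complex.I * (k : ℂ) ^ 2 * (t : ℂ))) * f k :=
  mulOp_ae_eq _ _ f

theorem norm_phase (k t : ℝ) : ‖Complex.exp (-(Complex.I * (k : ℂ) ^ 2 * (t : ℂ)))‖ = 1 := by
  rw [show -(Complex.I * (k : ℂ) ^ 2 * (t : ℂ)) = ((-(k ^ 2 * t) : ℝ) : ℂ) * Complex.I by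
    push_cast; ring, Complex.norm_exp_ofReal_mul_I]

theorem norm_freeEvolution (t : ℝ) (f : L2) : ‖freeEvolution t f‖ = ‖f‖ := by
  rw [Lp.norm_def, Lp.norm_def]
  congr 1
  refine eLpNorm_congr_norm_ae ?_
  filter_upwards [freeEvolution_ae_eq t f] with k hk
  rw [hk, norm_mul, norm_phase, one_mul]

theorem dilation_ae_eq {c : ℝ} (hc : 0 < c) (f : L2) :
    (dilation c hc f : ℝ → ℂ) =ᵐ[volume] fun x => (Real.sqrt c : ℂ) * f (c * x) :=
  (memLp_dilate hc f).coeFn_toLp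

theorem dilation_dilation_inv {c : ℝ} (hc : 0 < c) (f : L2) :
    dilation (1 / c) (by positivity) (dilation c hc f) = f := by
  refine Lp.ext ?_
  have hc' : 0 < 1 / c := by positivity
  filter_upwards [dilation_ae_eq hc' (dilation c hc f),
    (quasiMeasurePreserving_mul_left hc').ae (dilation_ae_eq hc f)] with x h1 h2
  rw [h1, h2, ← mul_assoc, ← Complex.ofReal_mul, ← Real.sqrt_mul hc'.le,
    show c * (1 / c * x) = x by field_simp, one_div_mul_cancel hc.ne']
  simp

theorem fourierL2_apply (f : L2) :
    fourierL2 f = dilation (1 / (2 * Real.pi)) (by positivity) (𝓕 f : L2) := rfl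

theorem norm_fourierL2 (f : L2) : ‖fourierL2 f‖ = ‖f‖ := by
  rw [fourierL2_apply, LinearIsometry.norm_map, Lp.norm_fourier_eq]

theorem fourierL2_fourierInv_dilation (f : L2) :
    fourierL2 (𝓕⁻ (dilation (2 * Real.pi) (by positivity) f : L2)) = f := by
  rw [fourierL2_apply, FourierTransform.fourier_fourierInv_eq, dilation_dilation_inv]

/-- The inverse of the unitary Fourier transform, in terms of Mathlib's one. -/
theorem adjoint_fourierL2_apply (f : L2) :
    ContinuousLinearMap.adjoint fourierL2 f =
      (𝓕⁻ (dilation (2 * Real.pi) (by positivity) f : L2) : L2) := by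
  have h := (ContinuousLinearMap.norm_map_iff_adjoint_comp_self fourierL2).1 norm_fourierL2
  have h' := DFunLike.congr_fun h (𝓕⁻ (dilation (2 * Real.pi) (by positivity) f : L2) : L2)
  rw [ContinuousLinearMap.comp_apply, fourierL2_fourierInv_dilation] at h'
  exact h'

/-- The position wave function at time `t` of the state whose momentum wave function is `φ`. -/
noncomputable def positionWave (t : ℝ) (φ : L2) : L2 :=
  ContinuousLinearMap.adjoint fourierL2 (freeEvolution t φ)

theorem positionWave_eq (t : ℝ) (φ : L2) :
    positionWave t φ =
      (𝓕⁻ (dilation (2 * Real.pi) (by positivity) (freeEvolution t φ) : L2) : L2) :=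
  adjoint_fourierL2_apply _

theorem fourier_positionWave (t : ℝ) (φ : L2) :
    (𝓕 (positionWave t φ) : L2) = dilation (2 * Real.pi) (by positivity) (freeEvolution t φ) := by
  rw [positionWave_eq, FourierTransform.fourier_fourierInv_eq]

theorem norm_positionWave (t : ℝ) (φ : L2) : ‖positionWave t φ‖ = ‖φ‖ := by
  rw [← Lp.norm_fourier_eq, fourier_positionWave, LinearIsometry.norm_map, norm_freeEvolution]

theorem norm_halfLineProj_le (f : L2) : ‖halfLineProj f‖ ≤ ‖f‖ := by
  refine Lp.norm_le_norm_of_ae_le ?_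
  filter_upwards [halfLineProj_ae_eq f] with x hx
  rw [hx]
  exact norm_indicator_le_norm_self _ _

theorem halfLineProj_idem (f : L2) : halfLineProj (halfLineProj f) = halfLineProj f := by
  refine Lp.ext ?_
  filter_upwards [halfLineProj_ae_eq f, halfLineProj_ae_eq (halfLineProj f)] with x h1 h2
  rw [h2]
  by_cases h : x ∈ Set.Ioi (0 : ℝ) <;> simp [h, h1]

theorem inner_halfLineProj_left (f g : L2) : ⟪halfLineProj f, g⟫_ℂ = ⟪f, halfLineProj g⟫_ℂ := by
  rw [MeasureTheory.L2.inner_def, MeasureTheory.L2.inner_def]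
  refine integral_congr_ae ?_
  filter_upwards [halfLineProj_ae_eq f, halfLineProj_ae_eq g] with x h1 h2
  rw [h1, h2]
  by_cases h : x ∈ Set.Ioi (0 : ℝ) <;> simp [h]

theorem inner_halfLineProj_self (f : L2) : ⟪f, halfLineProj f⟫_ℂ = (‖halfLineProj f‖ : ℂ) ^ 2 := by
  rw [← halfLineProj_idem, ← inner_halfLineProj_left, halfLineProj_idem,
    inner_self_eq_norm_sq_to_K]
  rfl

theorem positionProj_apply (t : ℝ) (φ : L2) :
    positionProj t φ = ContinuousLinearMap.adjoint (freeEvolution t)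
      (fourierL2 (halfLineProj (positionWave t φ))) := rfl

theorem inner_positionProj (t : ℝ) (φ : L2) :
    ⟪φ, positionProj t φ⟫_ℂ = (‖halfLineProj (positionWave t φ)‖ : ℂ) ^ 2 := by
  rw [positionProj_apply, ContinuousLinearMap.adjoint_inner_right,
    ← ContinuousLinearMap.adjoint_inner_left, ← inner_halfLineProj_self]
  rfl

theorem norm_adjoint_freeEvolution_le (t : ℝ) (f : L2) :
    ‖ContinuousLinearMap.adjoint (freeEvolution t) f‖ ≤ ‖f‖ := by
  refine (ContinuousLinearMap.le_opNorm _ _).trans (mul_le_of_le_one_left (norm_nonneg _) ?_)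
  rw [LinearIsometryEquiv.norm_map]
  exact ContinuousLinearMap.opNorm_le_bound _ zero_le_one fun g => by
    rw [norm_freeEvolution, one_mul]

theorem norm_positionProj_le (t : ℝ) (φ : L2) :
    ‖positionProj t φ‖ ≤ ‖halfLineProj (positionWave t φ)‖ := by
  rw [positionProj_apply]
  exact (norm_adjoint_freeEvolution_le _ _).trans (norm_fourierL2 _).le

/-- Since `φ = U* F (F* U φ)`, the complement of the projection acts on the position wave as `1 -
Π`. -/
theorem norm_sub_positionProj_le (t : ℝ) (φ : L2) :
    ‖φ - positionProj t φ‖ ≤ ‖positionWave t φ - halfLineProj (positionWave t φ)‖ := by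
  have h1 : ContinuousLinearMap.adjoint (freeEvolution t) (freeEvolution t φ) = φ :=
    DFunLike.congr_fun ((ContinuousLinearMap.norm_map_iff_adjoint_comp_self _).1
      (norm_freeEvolution t)) φ
  have h2 : fourierL2 (positionWave t φ) = freeEvolution t φ := by
    rw [positionWave, adjoint_fourierL2_apply, fourierL2_fourierInv_dilation]
  have h3 : φ - positionProj t φ = ContinuousLinearMap.adjoint (freeEvolution t)
      (fourierL2 (positionWave t φ - halfLineProj (positionWave t φ))) := by
    rw [map_sub, map_sub, h2, h1, positionProj_apply]
  rw [h3]
  exact (norm_adjoint_freeEvolution_le _ _).trans (norm_fourierL2 _).le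

/-! ### Approximate eigenvectors -/

theorem neg_one_mem_spectrum_of_approx {H : Type*} [NormedAddCommGroup H] [NormedSpace ℂ H]
    (T : H →L[ℂ] H) (h : ∀ ε > 0, ∃ v, ‖v‖ = 1 ∧ ‖T v + v‖ ≤ ε) : (-1 : ℂ) ∈ spectrum ℂ T := by
  intro hu
  obtain ⟨S, hS⟩ := hu.exists_left_inv
  -- With this tolerance a left inverse `S` of `-1 - T` would give `1 = ‖v‖ ≤ ‖S‖ε < 1`; the `+ 1`
  -- covers `S = 0`.
  obtain ⟨v, hv, hv'⟩ := h (1 / (2 * (‖S‖ + 1))) (by positivity)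
  have e : v = S (-(T v + v)) := by
    have := DFunLike.congr_fun hS v
    simp only [map_neg, map_one, mul_apply_eq_comp, sub_apply,
      neg_apply, one_apply_eq_self] at this
    rw [← this]
    congr 1
    rw [this]
    abel
  have h1 : ‖v‖ ≤ ‖S‖ * (1 / (2 * (‖S‖ + 1))) := by
    conv_lhs => rw [e]
    refine (S.le_opNorm _).trans ?_
    rw [norm_neg]
    gcongr
  rw [hv, mul_one_div, le_div_iff₀ (by positivity)] at h1
  linarith [norm_nonneg S]

/-! ### Boosted momentum boxes -/

/-- The momentum wave function `1_[a, a + 1]`. -/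
noncomputable def box (a : ℝ) : L2 :=
  indicatorConstLp 2 (measurableSet_Icc (a := a) (b := a + 1)) (by simp) (1 : ℂ)

theorem box_ae_eq (a : ℝ) :
    (box a : ℝ → ℂ) =ᵐ[volume] (Set.Icc a (a + 1)).indicator fun _ => (1 : ℂ) :=
  indicatorConstLp_coeFn

theorem norm_box (a : ℝ) : ‖box a‖ = 1 := by
  rw [box, norm_indicatorConstLp (by simp) (by simp)]
  simp

theorem halfLineProj_box {a : ℝ} (ha : 0 < a) : halfLineProj (box a) = box a := by
  refine Lp.ext ?_
  filter_upwards [halfLineProj_ae_eq (box a), box_ae_eq a] with x h1 h2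
  rw [h1]
  by_cases h : x ∈ Set.Ioi (0 : ℝ)
  · simp [h]
  · rw [Set.indicator_of_notMem h, h2, Set.indicator_of_notMem]
    exact fun h' => h (ha.trans_le h'.1)

/-- The evolved box, in the frequency variable of Mathlib's Fourier transform. -/
noncomputable def boxFreq (t a ξ : ℝ) : ℂ :=
  (Real.sqrt (2 * Real.pi) : ℂ) *
    (Complex.exp (-(Complex.I * ((2 * Real.pi * ξ : ℝ) : ℂ) ^ 2 * (t : ℂ))) *
      (Set.Icc a (a + 1)).indicator (fun _ => (1 : ℂ)) (2 * Real.pi * ξ))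

theorem dilation_freeEvolution_box (t a : ℝ) :
    (dilation (2 * Real.pi) (by positivity) (freeEvolution t (box a)) : ℝ → ℂ) =ᵐ[volume]
      boxFreq t a := by
  have hc : 0 < 2 * Real.pi := by positivity
  filter_upwards [dilation_ae_eq hc (freeEvolution t (box a)),
    (quasiMeasurePreserving_mul_left hc).ae (freeEvolution_ae_eq t (box a)),
    (quasiMeasurePreserving_mul_left hc).ae (box_ae_eq a)] with ξ h1 h2 h3
  rw [h1, h2, h3, boxFreq]

theorem memLp_boxFreq (t a : ℝ) : MemLp (boxFreq t a) 2 volume :=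
  (memLp_congr_ae (dilation_freeEvolution_box t a)).1 (Lp.memLp _)

theorem boxFreq_eq_indicator (t a : ℝ) :
    boxFreq t a = (Set.Icc (a / (2 * Real.pi)) ((a + 1) / (2 * Real.pi))).indicator
      (fun ξ : ℝ => (Real.sqrt (2 * Real.pi) : ℂ) *
        Complex.exp (-(Complex.I * ((2 * Real.pi * ξ : ℝ) : ℂ) ^ 2 * (t : ℂ)))) := by
  have hc : 0 < 2 * Real.pi := by positivity
  ext ξ
  have : 2 * Real.pi * ξ ∈ Set.Icc a (a + 1) ↔
      ξ ∈ Set.Icc (a / (2 * Real.pi)) ((a + 1) / (2 * Real.pi)) := by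
    rw [Set.mem_Icc, Set.mem_Icc, div_le_iff₀' hc, le_div_iff₀' hc]
  by_cases h : ξ ∈ Set.Icc (a / (2 * Real.pi)) ((a + 1) / (2 * Real.pi))
  · rw [Set.indicator_of_mem h, boxFreq, Set.indicator_of_mem (this.2 h), mul_one]
  · rw [Set.indicator_of_notMem h, boxFreq, Set.indicator_of_notMem (this.not.2 h), mul_zero,
      mul_zero]

theorem integrable_boxFreq (t a : ℝ) : Integrable (boxFreq t a) := by
  rw [boxFreq_eq_indicator]
  exact (Continuous.integrableOn_Icc (by fun_prop)).integrable_indicator measurableSet_Icc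

theorem positionWave_box_ae_eq (t a : ℝ) :
    (positionWave t (box a) : ℝ → ℂ) =ᵐ[volume] 𝓕⁻ (boxFreq t a) := by
  have : dilation (2 * Real.pi) (by positivity) (freeEvolution t (box a)) =
      (memLp_boxFreq t a).toLp := by
    refine Lp.ext ((dilation_freeEvolution_box t a).trans (memLp_boxFreq t a).coeFn_toLp.symm)
  rw [positionWave_eq, this]
  exact fourierInv_toLp_ae_eq (integrable_boxFreq t a) (memLp_boxFreq t a)

/-- Expanding `(k + a)² t` with `k = 2πη`, the cross term is linear in `η`: under the inverse
transform it becomes a translation by `2at`. -/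
theorem boxFreq_add (t a η : ℝ) :
    boxFreq t a (η + a / (2 * Real.pi)) =
      Complex.exp (((-(a ^ 2 * t + 4 * Real.pi * η * a * t) : ℝ) : ℂ) * I) * boxFreq t 0 η := by
  have hp : 2 * Real.pi * (η + a / (2 * Real.pi)) = 2 * Real.pi * η + a := by
    field_simp
  have hi : (Set.Icc a (a + 1)).indicator (fun _ => (1 : ℂ)) (2 * Real.pi * η + a) =
      (Set.Icc (0 : ℝ) (0 + 1)).indicator (fun _ => (1 : ℂ)) (2 * Real.pi * η) := by
    have : 2 * Real.pi * η + a ∈ Set.Icc a (a + 1) ↔ 2 * Real.pi * η ∈ Set.Icc (0 : ℝ) (0 + 1) := by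
      rw [Set.mem_Icc, Set.mem_Icc]
      constructor <;> rintro ⟨h1, h2⟩ <;> constructor <;> linarith
    by_cases h : 2 * Real.pi * η ∈ Set.Icc (0 : ℝ) (0 + 1)
    · rw [Set.indicator_of_mem h, Set.indicator_of_mem (this.2 h)]
    · rw [Set.indicator_of_notMem h, Set.indicator_of_notMem (this.not.2 h)]
  rw [boxFreq, boxFreq, hp, hi]
  have he : Complex.exp (-(Complex.I * ((2 * Real.pi * η + a : ℝ) : ℂ) ^ 2 * (t : ℂ))) =
      Complex.exp (((-(a ^ 2 * t + 4 * Real.pi * η * a * t) : ℝ) : ℂ) * I) *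
        Complex.exp (-(Complex.I * ((2 * Real.pi * η : ℝ) : ℂ) ^ 2 * (t : ℂ))) := by
    rw [← Complex.exp_add]
    congr 1
    push_cast
    ring
  rw [he]
  ring

/-- A boost by momentum `a` translates the position density at time `t` by `2 a t`. -/
theorem norm_fourierInv_boxFreq (t a x : ℝ) :
    ‖𝓕⁻ (boxFreq t a) x‖ = ‖𝓕⁻ (boxFreq t 0) (x - 2 * a * t)‖ := by
  have h : 𝓕⁻ (boxFreq t a) x =
      Complex.exp (((a * x - a ^ 2 * t : ℝ) : ℂ) * I) * 𝓕⁻ (boxFreq t 0) (x - 2 * a * t) := by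
    rw [Real.fourierInv_eq', Real.fourierInv_eq', ← integral_const_mul,
      ← integral_add_right_eq_self _ (a / (2 * Real.pi))]
    refine integral_congr_ae (Eventually.of_forall fun η => ?_)
    simp only [boxFreq_add, smul_eq_mul, ← mul_assoc, ← Complex.exp_add]
    congr 2
    have hp : ((2 * Real.pi * (a / (2 * Real.pi)) : ℝ) : ℂ) = a := by
      congr 1; field_simp
    have e : 2 * Real.pi * inner ℝ (η + a / (2 * Real.pi)) x = 2 * Real.pi * η * x + a * x := by
      simp only [RCLike.inner_apply, conj_trivial]
      field_simp
    rw [e]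
    simp only [RCLike.inner_apply, conj_trivial]
    push_cast
    ring
  rw [h, norm_mul, Complex.norm_exp_ofReal_mul_I, one_mul]

theorem setIntegral_positionWave_box (t a : ℝ) {s : Set ℝ} (hs : MeasurableSet s) :
    ∫ x in s, ‖positionWave t (box a) x‖ ^ 2 =
      ∫ y in (fun y => y + 2 * a * t) ⁻¹' s, ‖positionWave t (box 0) y‖ ^ 2 := by
  have h1 : ∀ b, (fun x => ‖positionWave t (box b) x‖ ^ 2) =ᵐ[volume]
      fun x => ‖𝓕⁻ (boxFreq t b) x‖ ^ 2 := fun b => by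
    filter_upwards [positionWave_box_ae_eq t b] with x hx
    rw [hx]
  rw [integral_congr_ae (ae_restrict_of_ae (h1 a)), integral_congr_ae (ae_restrict_of_ae (h1 0)),
    ← integral_indicator hs, ← integral_indicator (hs.preimage (by fun_prop)),
    ← integral_add_right_eq_self _ (2 * a * t)]
  congr 1
  ext y
  by_cases h : y + 2 * a * t ∈ s
  · rw [Set.indicator_of_mem h, Set.indicator_of_mem (by exact h), norm_fourierInv_boxFreq,
      add_sub_cancel_right]
  · rw [Set.indicator_of_notMem h, Set.indicator_of_notMem (by exact h)]

/-! ### Mass on half-lines and its decay -/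

theorem norm_sq_eq_integral (f : L2) : ‖f‖ ^ 2 = ∫ x, ‖f x‖ ^ 2 := by
  have h := inner_self_eq_norm_sq_to_K (𝕜 := ℂ) f
  rw [MeasureTheory.L2.inner_def] at h
  simp only [inner_self_eq_norm_sq_to_K] at h
  apply Complex.ofReal_injective
  rw [← integral_complex_ofReal]
  push_cast
  exact h.symm

theorem norm_sq_halfLineProj (f : L2) : ‖halfLineProj f‖ ^ 2 = ∫ x in Set.Ioi 0, ‖f x‖ ^ 2 := by
  rw [norm_sq_eq_integral, ← integral_indicator measurableSet_Ioi]
  refine integral_congr_ae ?_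
  filter_upwards [halfLineProj_ae_eq f] with x hx
  rw [hx]
  by_cases h : x ∈ Set.Ioi (0 : ℝ) <;> simp [h]

theorem norm_sq_sub_halfLineProj (f : L2) :
    ‖f - halfLineProj f‖ ^ 2 = ∫ x in Set.Iic 0, ‖f x‖ ^ 2 := by
  rw [norm_sq_eq_integral, ← integral_indicator measurableSet_Iic]
  refine integral_congr_ae ?_
  filter_upwards [halfLineProj_ae_eq f, Lp.coeFn_sub f (halfLineProj f)] with x hx h'
  rw [h', Pi.sub_apply, hx]
  by_cases h : 0 < x
  · simp [h]
  · simp [h, not_lt.1 h]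

theorem tendsto_setIntegral_norm_sq (f : L2) {s : ℕ → Set ℝ} (hs : ∀ n, MeasurableSet (s n))
    (ha : Antitone s) (he : ⋂ n, s n = ∅) :
    Tendsto (fun n => ∫ x in s n, ‖f x‖ ^ 2) atTop (𝓝 0) := by
  have hf : Integrable fun x => ‖f x‖ ^ 2 := (Lp.memLp f).integrable_norm_pow (by norm_num)
  have := tendsto_setIntegral_of_antitone hs ha ⟨0, hf.integrableOn⟩
  rwa [he, setIntegral_empty] at this

theorem tendsto_norm_of_sq {u : ℕ → ℝ} (h0 : ∀ n, 0 ≤ u n)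
    (h : Tendsto (fun n => u n ^ 2) atTop (𝓝 0)) : Tendsto u atTop (𝓝 0) := by
  have := (Real.continuous_sqrt.tendsto 0).comp h
  rw [Real.sqrt_zero] at this
  exact this.congr fun n => Real.sqrt_sq (h0 n)

/-- Undoing the boost turns the mass on `x > 0` into the mass of the fixed wave of `box 0` on `x >
2n`, a tail of an integrable function. -/
theorem tendsto_halfLineProj_past :
    Tendsto (fun n : ℕ => ‖halfLineProj (positionWave (-1) (box n))‖) atTop (𝓝 0) := by
  refine tendsto_norm_of_sq (fun _ => norm_nonneg _) ?_
  have h := tendsto_setIntegral_norm_sq (positionWave (-1) (box 0))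
    (s := fun n : ℕ => Set.Ioi (2 * (n : ℝ))) (fun n => measurableSet_Ioi)
    (fun m n hmn => Set.Ioi_subset_Ioi (by gcongr)) (by
      ext x
      obtain ⟨n, hn⟩ := exists_nat_gt x
      simp only [Set.mem_iInter, Set.mem_Ioi, Set.mem_empty_iff_false, iff_false, not_forall]
      exact ⟨n, by linarith [n.cast_nonneg (α := ℝ)]⟩)
  refine h.congr fun n => ?_
  rw [norm_sq_halfLineProj, setIntegral_positionWave_box _ (n : ℝ) measurableSet_Ioi]
  congr 2
  ext y
  simp only [Set.mem_preimage, Set.mem_Ioi]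
  constructor <;> intro h <;> linarith

theorem tendsto_halfLineProj_future :
    Tendsto (fun n : ℕ => ‖positionWave 1 (box n) - halfLineProj (positionWave 1 (box n))‖)
      atTop (𝓝 0) := by
  refine tendsto_norm_of_sq (fun _ => norm_nonneg _) ?_
  have h := tendsto_setIntegral_norm_sq (positionWave 1 (box 0))
    (s := fun n : ℕ => Set.Iic (-(2 * (n : ℝ)))) (fun n => measurableSet_Iic)
    (fun m n hmn => Set.Iic_subset_Iic.2 (by gcongr)) (by
      ext x
      obtain ⟨n, hn⟩ := exists_nat_gt (-x)
      simp only [Set.mem_iInter, Set.mem_Iic, Set.mem_empty_iff_false, iff_false, not_forall]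
      exact ⟨n, by linarith [n.cast_nonneg (α := ℝ)]⟩)
  refine h.congr fun n => ?_
  rw [norm_sq_sub_halfLineProj, setIntegral_positionWave_box _ (n : ℝ) measurableSet_Iic]
  congr 2
  ext y
  simp only [Set.mem_preimage, Set.mem_Iic]
  constructor <;> intro h <;> linarith

/-! ### The point `-1` in the spectrum -/

theorem backflowOperator_apply (T : ℝ) (φ : L2) :
    backflowOperator T φ =
      halfLineProj (positionProj (-T) (halfLineProj φ) - positionProj T (halfLineProj φ)) := rfl

theorem norm_backflowOperator_add_le {T : ℝ} {φ : L2} (hφ : halfLineProj φ = φ) :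
    ‖backflowOperator T φ + φ‖ ≤ ‖halfLineProj (positionWave (-T) φ)‖ +
      ‖positionWave T φ - halfLineProj (positionWave T φ)‖ := by
  have h : backflowOperator T φ + φ =
      halfLineProj (positionProj (-T) φ + (φ - positionProj T φ)) := by
    rw [backflowOperator_apply, hφ, map_sub, map_add, map_sub, hφ]
    abel
  rw [h]
  exact (norm_halfLineProj_le _).trans ((norm_add_le _ _).trans
    (add_le_add (norm_positionProj_le _ _) (norm_sub_positionProj_le _ _)))

theorem neg_one_mem_spectrum_backflowOperator : (-1 : ℂ) ∈ spectrum ℂ (backflowOperator 1) := by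
  refine neg_one_mem_spectrum_of_approx _ fun ε hε => ?_
  have h := tendsto_halfLineProj_past.add tendsto_halfLineProj_future
  rw [add_zero] at h
  -- `n = 0` is discarded because `halfLineProj_box` needs a positive left endpoint.
  obtain ⟨n, hn, hn0⟩ := ((h.eventually_lt_const hε).and (eventually_gt_atTop 0)).exists
  exact ⟨box n, norm_box _, (norm_backflowOperator_add_le
    (halfLineProj_box (Nat.cast_pos.2 hn0))).trans hn.le⟩

/-! ### Cauchy transforms and half-line supports -/

theorem inner_toLp_fourier {e : ℝ → ℂ} (h1 : Integrable e) (h2 : MemLp e 2 volume) (h : L2) :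
    ∫ ξ, (𝓕 h : L2) ξ * starRingEnd ℂ (e ξ) = ∫ x, h x * starRingEnd ℂ (𝓕⁻ e x) := by
  have key : ⟪(h2.toLp e : L2), (𝓕 h : L2)⟫_ℂ = ⟪(𝓕⁻ (h2.toLp e : L2) : L2), h⟫_ℂ := by
    rw [← Lp.inner_fourier_eq (𝓕⁻ (h2.toLp e : L2) : L2), FourierTransform.fourier_fourierInv_eq]
  rw [MeasureTheory.L2.inner_def, MeasureTheory.L2.inner_def] at key
  refine Eq.trans ?_ (key.trans ?_)
  · refine integral_congr_ae ?_
    filter_upwards [h2.coeFn_toLp] with x hx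
    rw [hx, RCLike.inner_apply]
  · refine integral_congr_ae ?_
    filter_upwards [fourierInv_toLp_ae_eq h1 h2] with x hx
    rw [hx, RCLike.inner_apply]

theorem memLp_two_indicator_exp {a : ℂ} {s : Set ℝ} (hs : MeasurableSet s)
    (h : IntegrableOn (fun ξ : ℝ => Complex.exp (2 * a * ξ)) s) :
    MemLp (s.indicator fun ξ : ℝ => Complex.exp (a * ξ)) 2 volume := by
  rw [memLp_indicator_iff_restrict hs]
  refine (memLp_two_iff_integrable_sq_norm (by fun_prop)).2 ?_
  refine (h.norm).congr (Eventually.of_forall fun ξ => ?_)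
  dsimp only
  rw [← norm_pow, ← Complex.exp_nat_mul]
  congr 2
  push_cast
  ring

/-- Unitarity applied to `e^{aξ}` cut off to `s`; the exponent `2a` in `h2` expresses square
integrability. It serves both half-lines. -/
theorem setIntegral_exp_mul_fourier {a : ℂ} {s : Set ℝ} (hs : MeasurableSet s)
    (h1 : IntegrableOn (fun ξ : ℝ => Complex.exp (a * ξ)) s)
    (h2 : IntegrableOn (fun ξ : ℝ => Complex.exp (2 * a * ξ)) s) (h : L2) :
    ∫ ξ in s, (𝓕 h : L2) ξ * Complex.exp (starRingEnd ℂ a * ξ) =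
      ∫ x, h x * starRingEnd ℂ (∫ ξ in s, Complex.exp ((a + 2 * Real.pi * x * I) * ξ)) := by
  have key := inner_toLp_fourier ((integrable_indicator_iff hs).2 h1)
    (memLp_two_indicator_exp hs h2) h
  rw [← integral_indicator hs]
  refine Eq.trans ?_ (key.trans ?_)
  · congr 1
    ext ξ
    by_cases hξ : ξ ∈ s
    · simp [hξ, ← Complex.exp_conj]
    · simp [hξ]
  · congr 1
    ext x
    rw [Real.fourierInv_eq', ← integral_indicator hs]
    congr 3
    ext ξ
    by_cases hξ : ξ ∈ s
    · simp only [hξ, Set.indicator_of_mem, smul_eq_mul, ← Complex.exp_add, RCLike.inner_apply,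
        conj_trivial]
      congr 1
      push_cast
      ring
    · simp [hξ]

theorem cauchy_eq_right {z : ℂ} (hz : 0 < z.im) (h : L2) :
    -- The Cauchy kernel appears as the Laplace integral of an exponential, convergent since `Re
    -- (2πiz) = -2π Im z < 0`.
    ∫ ξ in Set.Ioi (0 : ℝ), (𝓕 h : L2) ξ * Complex.exp (2 * Real.pi * I * z * ξ) =
      -(2 * Real.pi * I)⁻¹ * ∫ x, h x * (z - x)⁻¹ := by
  set a : ℂ := starRingEnd ℂ (2 * Real.pi * I * z) with ha
  have hre : a.re < 0 := by
    simp [ha]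
    positivity
  have hre2 : (2 * a).re < 0 := by
    rw [two_mul, add_re]
    linarith
  have := setIntegral_exp_mul_fourier (a := a) measurableSet_Ioi
    (integrableOn_exp_mul_complex_Ioi hre 0)
    (integrableOn_exp_mul_complex_Ioi hre2 0) h
  rw [ha, Complex.conj_conj] at this
  rw [this, ← integral_const_mul]
  congr 1
  ext x
  rw [integral_exp_mul_complex_Ioi (by simpa [ha] using hre)]
  simp only [ofReal_zero, mul_zero, Complex.exp_zero, map_div₀, map_one, map_add,
    Complex.conj_conj, map_mul, map_neg, neg_neg, conj_I, conj_ofReal, map_ofNat]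
  rw [show 2 * (Real.pi : ℂ) * I * z + 2 * Real.pi * x * -I = (2 * Real.pi * I) * (z - x) by ring,
    div_eq_mul_inv, mul_inv]
  ring

theorem cauchy_eq_left {z : ℂ} (hz : z.im < 0) (h : L2) :
    ∫ ξ in Set.Iic (0 : ℝ), (𝓕 h : L2) ξ * Complex.exp (2 * Real.pi * I * z * ξ) =
      (2 * Real.pi * I)⁻¹ * ∫ x, h x * (z - x)⁻¹ := by
  set a : ℂ := starRingEnd ℂ (2 * Real.pi * I * z) with ha
  have hre : 0 < a.re := by
    have := mul_pos Real.pi_pos (neg_pos.2 hz)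
    simp [ha]
    linarith
  have := setIntegral_exp_mul_fourier (a := a) measurableSet_Iic
    (integrableOn_exp_mul_complex_Iic hre 0)
    (integrableOn_exp_mul_complex_Iic (by simpa using hre) 0) h
  rw [ha, Complex.conj_conj] at this
  rw [this, ← integral_const_mul]
  congr 1
  ext x
  rw [integral_exp_mul_complex_Iic (by simpa [ha] using hre)]
  simp only [ofReal_zero, mul_zero, Complex.exp_zero, map_div₀, map_one, map_add,
    Complex.conj_conj, map_mul, map_neg, neg_neg, conj_I, conj_ofReal, map_ofNat]
  rw [show 2 * (Real.pi : ℂ) * I * z + 2 * Real.pi * x * -I = (2 * Real.pi * I) * (z - x) by ring,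
    one_div, mul_inv]
  ring

/-- Paired with an `L²` function, this gives the integrable majorant for the Cauchy kernel. -/
theorem memLp_inv_one_add_abs : MemLp (fun x : ℝ => (1 + |x|)⁻¹) 2 volume := by
  have hc : Continuous fun x : ℝ => (1 + |x|)⁻¹ :=
    Continuous.inv₀ (by fun_prop) fun x => by positivity
  refine (memLp_two_iff_integrable_sq hc.aestronglyMeasurable).2 ?_
  refine integrable_inv_one_add_sq.mono' (hc.pow 2).aestronglyMeasurable
    (Eventually.of_forall fun x => ?_)
  rw [Real.norm_of_nonneg (by positivity), inv_pow]
  refine inv_anti₀ (by positivity) ?_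
  nlinarith [abs_nonneg x, sq_abs x]

theorem integrable_norm_mul_inv_one_add_abs (h : L2) :
    Integrable fun x : ℝ => ‖h x‖ * (1 + |x|)⁻¹ :=
  (Lp.memLp h).norm.integrable_mul memLp_inv_one_add_abs

/-- The Cauchy transform of a function on the negative half-line is holomorphic on the
slit plane. -/
theorem differentiableOn_cauchy (h : L2) :
    DifferentiableOn ℂ (fun z : ℂ => ∫ x in Set.Iic (0 : ℝ), h x * (z - x)⁻¹) slitPlane := by
  intro z₀ hz₀
  obtain ⟨ε, hε, hball⟩ := Metric.isOpen_iff.1 isOpen_slitPlane z₀ hz₀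
  have hx1 : ∀ x : ℝ, x ≤ 0 → ε ≤ ‖z₀ - x‖ := fun x hx => by
    by_contra! hlt
    have : (x : ℂ) ∈ slitPlane := hball (by rwa [mem_ball_iff_norm, norm_sub_rev])
    exact absurd (ofReal_mem_slitPlane.1 this) hx.not_gt
  -- From `|x| ≤ ‖z₀‖ + ‖z₀ - x‖` and `ε ≤ ‖z₀ - x‖`.
  obtain ⟨K, hK, hx2⟩ : ∃ K : ℝ, 0 < K ∧ ∀ x : ℝ, x ≤ 0 → 1 + |x| ≤ K * ‖z₀ - x‖ := by
    refine ⟨(1 + ‖z₀‖) / ε + 1, by positivity, fun x hx => ?_⟩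
    have e1 : |x| ≤ ‖z₀‖ + ‖z₀ - x‖ := by
      have := norm_sub_le z₀ (z₀ - x)
      rwa [sub_sub_cancel, Complex.norm_real, Real.norm_eq_abs] at this
    have e2 : 1 + ‖z₀‖ ≤ (1 + ‖z₀‖) / ε * ‖z₀ - x‖ := by
      rw [div_mul_eq_mul_div, le_div_iff₀ hε]
      exact mul_le_mul_of_nonneg_left (hx1 x hx) (by positivity)
    linarith
  have hx3 : ∀ x : ℝ, x ≤ 0 → ∀ z ∈ Metric.ball z₀ (ε / 2), ‖z₀ - x‖ / 2 ≤ ‖z - x‖ := by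
    intro x hx z hz
    have := norm_sub_norm_le (z₀ - x) (z₀ - z)
    rw [sub_sub_sub_cancel_left] at this
    rw [mem_ball_iff_norm, norm_sub_rev] at hz
    linarith [hx1 x hx]
  have hmeas : ∀ z : ℂ, AEStronglyMeasurable (fun x : ℝ => h x * (z - x)⁻¹)
      (volume.restrict (Set.Iic 0)) := fun z =>
    (Lp.aestronglyMeasurable h).restrict.mul (by fun_prop)
  have hmeas' : AEStronglyMeasurable (fun x : ℝ => h x * (-((z₀ - x) ^ 2)⁻¹))
      (volume.restrict (Set.Iic 0)) :=
    (Lp.aestronglyMeasurable h).restrict.mul (by fun_prop)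
  have hint := (integrable_norm_mul_inv_one_add_abs h).restrict (s := Set.Iic 0)
  -- The bound comes from `‖z - x‖⁻² ≤ 4‖z₀ - x‖⁻² ≤ (4/ε)‖z₀ - x‖⁻¹ ≤ (4K/ε)(1 + |x|)⁻¹`.
  refine (hasDerivAt_integral_of_dominated_loc_of_deriv_le (𝕜 := ℂ)
    (F := fun z x => h x * (z - x)⁻¹) (F' := fun z x => h x * (-((z - x) ^ 2)⁻¹))
    (bound := fun x => (4 * K / ε) * (‖h x‖ * (1 + |x|)⁻¹)) (Metric.ball_mem_nhds z₀ (half_pos hε))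
    (Eventually.of_forall hmeas) ?_ hmeas' ?_ (hint.const_mul _) ?_).2.differentiableAt
    |>.differentiableWithinAt
  · refine (hint.const_mul K).mono' (hmeas z₀) ?_
    refine (ae_restrict_iff' measurableSet_Iic).2 (Eventually.of_forall fun x hx => ?_)
    rw [norm_mul, norm_inv, mul_left_comm]
    refine mul_le_mul_of_nonneg_left ?_ (norm_nonneg _)
    have := hx1 x hx
    have h2 := hx2 x hx
    rw [← div_eq_mul_inv, inv_eq_one_div, div_le_div_iff₀ (by linarith) (by positivity)]
    linarith
  · refine (ae_restrict_iff' measurableSet_Iic).2 (Eventually.of_forall fun x hx z hz => ?_)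
    rw [norm_mul, norm_neg, norm_inv, norm_pow, mul_left_comm]
    refine mul_le_mul_of_nonneg_left ?_ (norm_nonneg _)
    have h1 := hx1 x hx
    have h2 := hx2 x hx
    have h3 := hx3 x hx z hz
    have h4 : 0 < ‖z - x‖ := by linarith
    rw [← div_eq_mul_inv, inv_eq_one_div, div_div, div_le_div_iff₀ (by positivity) (by positivity)]
    have h5 : (‖z₀ - x‖ / 2) * (‖z₀ - x‖ / 2) ≤ ‖z - x‖ ^ 2 := by
      rw [sq]
      exact mul_le_mul h3 h3 (by positivity) h4.le
    have h6 : ε * (1 + |x|) ≤ ‖z₀ - x‖ * (K * ‖z₀ - x‖) := by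
      exact mul_le_mul h1 h2 (by positivity) (by linarith)
    have h7 := mul_le_mul_of_nonneg_left h5 hK.le
    linarith
  · refine (ae_restrict_iff' measurableSet_Iic).2 (Eventually.of_forall fun x hx z hz => ?_)
    have h4 : z - x ≠ 0 := by
      rw [← norm_pos_iff]
      linarith [hx1 x hx, hx3 x hx z hz]
    have := (((hasDerivAt_id z).sub_const (x : ℂ)).inv h4).const_mul (h x)
    rw [id, neg_div, one_div] at this
    exact this

theorem eq_zero_of_forall_setIntegral_exp {g : L2} (h0 : ∀ᵐ ξ, ξ < 0 → g ξ = 0)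
    (h : ∀ z : ℂ, 0 < z.im →
      ∫ ξ in Set.Ioi (0 : ℝ), g ξ * Complex.exp (2 * Real.pi * I * z * ξ) = 0) : g = 0 := by
  -- The damping `e^{-ξ}` puts `g e` in `L¹ ∩ L²`, where the inverse transform is an integral and is
  -- injective.
  set e : ℝ → ℂ := (Set.Ioi (0 : ℝ)).indicator fun ξ : ℝ => Complex.exp (-1 * ξ) with he
  have he2 : MemLp e 2 volume := memLp_two_indicator_exp measurableSet_Ioi
    (integrableOn_exp_mul_complex_Ioi (by simp) 0)
  have hei : MemLp e ∞ volume := by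
    refine memLp_top_of_bound he2.1 1 (Eventually.of_forall fun ξ => ?_)
    by_cases hξ : ξ ∈ Set.Ioi (0 : ℝ)
    · rw [he, Set.indicator_of_mem hξ, Complex.norm_exp]
      simpa using (Set.mem_Ioi.1 hξ).le
    · simp [he, Set.indicator_of_notMem hξ]
  have f1 : Integrable fun ξ => g ξ * e ξ := (Lp.memLp g).integrable_mul he2
  have f2 : MemLp (fun ξ => g ξ * e ξ) 2 volume := hei.mul (Lp.memLp g)
  have hF : 𝓕⁻ (fun ξ => g ξ * e ξ) = 0 := by
    ext x
    have hπ : (Real.pi : ℂ) ≠ 0 := by exact_mod_cast Real.pi_ne_zero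
    -- On the line `Im z = 1/(2π)`, `e^{2πizξ} = e^{2πixξ} e^{-ξ}`.
    have hz := h (x + (1 / (2 * Real.pi) : ℝ) * I) (by simp; positivity)
    rw [Real.fourierInv_eq', Pi.zero_apply, ← hz, ← integral_indicator measurableSet_Ioi]
    congr 1
    ext ξ
    by_cases hξ : ξ ∈ Set.Ioi (0 : ℝ)
    · rw [Set.indicator_of_mem hξ, he, Set.indicator_of_mem hξ, smul_eq_mul, mul_left_comm,
        ← Complex.exp_add]
      congr 2
      simp only [RCLike.inner_apply, conj_trivial]
      push_cast
      field_simp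
      ring_nf
      simp
      ring
    · simp [he, Set.indicator_of_notMem hξ]
  have hL : (f2.toLp : L2) = 0 := by
    have h1 : (𝓕⁻ (f2.toLp : L2) : L2) = 0 := by
      refine Lp.ext ?_
      filter_upwards [fourierInv_toLp_ae_eq f1 f2, Lp.coeFn_zero ℂ 2 (volume : Measure ℝ)]
        with x h1 h2
      rw [h1, h2, hF]
    exact (Lp.fourierTransformₗᵢ ℝ ℂ).symm.injective (h1.trans (map_zero _).symm)
  refine Lp.ext ?_
  have hne : ∀ᵐ ξ : ℝ, ξ ≠ 0 := by simp [ae_iff]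
  filter_upwards [h0, hne, f2.coeFn_toLp, Lp.coeFn_zero ℂ 2 (volume : Measure ℝ)] with ξ h1 h2 h3 h4
  rw [h4]
  rcases lt_or_gt_of_ne h2 with hξ | hξ
  · exact h1 hξ
  · rw [hL, h4, he, Set.indicator_of_mem (Set.mem_Ioi.2 hξ)] at h3
    exact (mul_eq_zero.1 h3.symm).resolve_right (Complex.exp_ne_zero _)

/-- A function in `L²` that is supported on a half-line, and whose Fourier transform is supported
on a half-line, is zero. -/
theorem eq_zero_of_halfLine_supports {h : L2} (hpos : ∀ᵐ x, 0 < x → h x = 0)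
    (hneg : ∀ᵐ ξ, ξ < 0 → (𝓕 h : L2) ξ = 0) : h = 0 := by
  have hC : ∀ z : ℂ, ∫ x, h x * (z - x)⁻¹ = ∫ x in Set.Iic (0 : ℝ), h x * (z - x)⁻¹ := fun z => by
    rw [← integral_indicator measurableSet_Iic]
    refine integral_congr_ae ?_
    filter_upwards [hpos] with x hx
    by_cases h' : 0 < x
    · simp [hx h', h']
    · simp [not_lt.1 h']
  have hlow : ∀ z : ℂ, z.im < 0 → ∫ x in Set.Iic (0 : ℝ), h x * (z - x)⁻¹ = 0 := fun z hz => by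
    have h1 := cauchy_eq_left hz h
    have h2 : ∫ ξ in Set.Iic (0 : ℝ), (𝓕 h : L2) ξ * Complex.exp (2 * Real.pi * I * z * ξ) = 0 := by
      rw [integral_Iic_eq_integral_Iio]
      refine setIntegral_eq_zero_of_ae_eq_zero ?_
      filter_upwards [hneg] with ξ h' hξ
      rw [h' hξ, zero_mul]
    rw [h2, hC] at h1
    exact (mul_eq_zero.1 h1.symm).resolve_left
      (inv_ne_zero two_pi_I_ne_zero)
  -- Identity theorem on the connected slit plane, which joins the two half-planes through the
  -- positive axis.
  have hall : Set.EqOn (fun z : ℂ => ∫ x in Set.Iic (0 : ℝ), h x * (z - x)⁻¹) 0 slitPlane := by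
    refine ((differentiableOn_cauchy h).analyticOnNhd isOpen_slitPlane)
      |>.eqOn_zero_of_preconnected_of_eventuallyEq_zero
      (starConvex_one_slitPlane.isPathConnected one_mem_slitPlane).isConnected.isPreconnected
      (z₀ := -I) (by simp [mem_slitPlane_iff]) ?_
    filter_upwards [(isOpen_lt Complex.continuous_im continuous_const).mem_nhds
      (show (-I : ℂ).im < 0 by simp)] with z hz
    exact hlow z hz
  have hg : (𝓕 h : L2) = 0 := eq_zero_of_forall_setIntegral_exp hneg fun z hz => by
    rw [cauchy_eq_right hz, hC]
    have : ∫ x in Set.Iic (0 : ℝ), h x * (z - x)⁻¹ = 0 :=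
      hall (mem_slitPlane_iff.2 (Or.inr hz.ne'))
    rw [this, mul_zero]
  rw [← norm_eq_zero, ← Lp.norm_fourier_eq, hg, norm_zero]

/-! ### Absence of eigenvectors -/

theorem halfLineProj_eq_self_of_backflow {T : ℝ} {φ : L2} (h : backflowOperator T φ = -φ) :
    halfLineProj φ = φ := by
  rw [← neg_inj, ← map_neg, ← h, backflowOperator_apply, halfLineProj_idem]

/-- The two masses differ by `-‖φ‖²`, while the one subtracted is at most `‖φ‖²`; hence the other is
zero. -/
theorem halfLineProj_positionWave_eq_zero {T : ℝ} {φ : L2} (h : backflowOperator T φ = -φ) :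
    halfLineProj (positionWave (-T) φ) = 0 := by
  have hφ := halfLineProj_eq_self_of_backflow h
  have h1 : ⟪φ, backflowOperator T φ⟫_ℂ =
      (‖halfLineProj (positionWave (-T) φ)‖ : ℂ) ^ 2 -
        (‖halfLineProj (positionWave T φ)‖ : ℂ) ^ 2 := by
    rw [backflowOperator_apply, hφ, ← inner_halfLineProj_left, hφ, inner_sub_right,
      inner_positionProj, inner_positionProj]
  rw [h, inner_neg_right, inner_self_eq_norm_sq_to_K] at h1
  have h2 : -‖φ‖ ^ 2 =
      ‖halfLineProj (positionWave (-T) φ)‖ ^ 2 - ‖halfLineProj (positionWave T φ)‖ ^ 2 := by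
    apply Complex.ofReal_injective
    push_cast
    exact h1
  have h3 : ‖halfLineProj (positionWave T φ)‖ ≤ ‖φ‖ :=
    (norm_halfLineProj_le _).trans (norm_positionWave _ _).le
  have h4 := pow_le_pow_left₀ (norm_nonneg _) h3 2
  rw [← norm_eq_zero, ← sq_eq_zero_iff]
  exact le_antisymm (by linarith) (sq_nonneg _)

theorem eq_zero_of_backflowOperator_eq_neg {T : ℝ} {φ : L2} (h : backflowOperator T φ = -φ) :
    φ = 0 := by
  have hc : 0 < 2 * Real.pi := by positivity
  have hφ := halfLineProj_eq_self_of_backflow h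
  rw [← norm_eq_zero, ← norm_positionWave (-T), norm_eq_zero]
  -- The phase and the dilation by `2π > 0` preserve the vanishing on negative momenta.
  refine eq_zero_of_halfLine_supports ?_ ?_
  · have h1 := halfLineProj_ae_eq (positionWave (-T) φ)
    rw [halfLineProj_positionWave_eq_zero h] at h1
    filter_upwards [h1, Lp.coeFn_zero ℂ 2 (volume : Measure ℝ)] with x h1 h2 hx
    rw [h2, Set.indicator_of_mem (Set.mem_Ioi.2 hx)] at h1
    exact h1.symm
  · have h1 := halfLineProj_ae_eq φ
    rw [hφ] at h1
    have h2 := (quasiMeasurePreserving_mul_left hc).ae h1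
    have h3 := (quasiMeasurePreserving_mul_left hc).ae (freeEvolution_ae_eq (-T) φ)
    rw [fourier_positionWave]
    filter_upwards [dilation_ae_eq hc (freeEvolution (-T) φ), h2, h3] with ξ h4 h5 h6 hξ
    rw [h4, h6, h5, Set.indicator_of_notMem, mul_zero, mul_zero]
    exact fun h' => absurd (Set.mem_Ioi.1 h') (mul_neg_of_pos_of_neg hc hξ).not_gt

theorem not_hasEigenvalue_backflowOperator :
    ¬ Module.End.HasEigenvalue (backflowOperator 1 : L2 →ₗ[ℂ] L2) (-1 : ℂ) := by
  intro hev
  obtain ⟨φ, hφ, hne⟩ := hev.exists_hasEigenvector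
  refine hne (eq_zero_of_backflowOperator_eq_neg (T := 1) ?_)
  simpa using Module.End.mem_eigenspace_iff.1 hφ

end Backflow

theorem proposition3 :
    ¬ IsCompactOperator (Backflow.backflowOperator 1) ∧
      (-1 : ℂ) ∈ spectrum ℂ (Backflow.backflowOperator 1) ∧
      ¬ Module.End.HasEigenvalue
        (Backflow.backflowOperator 1 : Backflow.L2 →ₗ[ℂ] Backflow.L2) (-1 : ℂ) :=
  ⟨fun hc => Backflow.not_hasEigenvalue_backflowOperator
      ((hc.hasEigenvalue_iff_mem_spectrum (by simp)).2
        Backflow.neg_one_mem_spectrum_backflowOperator),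
    Backflow.neg_one_mem_spectrum_backflowOperator,
    Backflow.not_hasEigenvalue_backflowOperator⟩
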